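/- For each $n\ge 1$ let $\mathbb{P}_n$ be a probability distribution on $\{1,\dots,n\}$, and write $\mathbb{P}_n(i)=\frac1n+\varepsilon_{i,n}$ for $1\le i\le n$ (so $\varepsilon_{i,n}\in[-\frac1n,1-\frac1n]$ and $\sum_{i=1}^n\varepsilon_{i,n}=0$). Suppose that the following two conditions hold. (i) There is a constant $C$ such that for all $n\ge 2$ and all primes $p>n^{1/\log\log n}$, $$\sum_{l=1}^{\lfloor n/p\rfloor}\varepsilon_{lp,n}\le\frac{C}{p}.$$ (ii) There is a constant $D$ such that for all $n\ge 2$, all $k\ge 1$, and all $k$-tuples $(p_1,\dots,p_k)$ of distinct primes with $p_i\le n^{1/\log\log n}$ for every $i$, $$0\le\sum_{l=1}^{\lfloor n/(p_1\cdots p_k)\rfloor}\varepsilon_{lp_1\cdots p_k,n}\le\frac{D}{n}.$$ Let $\omega(m)$ denote the number of distinct prime factors of $m$ and let $Z\sim\mathcal{N}(0,1)$. Then for every real $x$, as $n\to\infty$, $$\mathbb{P}_n\big(m\le n:\ \omega(m)-\log\log n\le x(\log\log n)^{1/2}\big)\to\mathbb{P}(Z\le x).$$ -/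

import Mathlib

open MeasureTheory ProbabilityTheory Filter Topology

/-!
Let `s = √(log log n)`, and call a prime *small* when it is at most `n ^ (1 / log log n)`. The proof
shows that the characteristic function of `(ω(m) - s²) / s` tends to `exp (-t² / 2)` and concludes
with Lévy's continuity theorem and the portmanteau theorem.

* **Large primes do not matter.** By Mertens' second theorem the reciprocals of the primes between
  `n ^ (1 / log log n)` and `n` have sum `O(log log log n)`, so by the hypothesis on large primes the
  mean number of large prime factors of `m` is `o(s)`; dropping them changes the characteristic
  function by `o(1)` (`norm_integral_exp_normalizedOmega_sub_le`).
* **Small primes behave independently.** By the hypothesis on tuples, a product `d` of distinct small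
  primes divides `m` with probability `1 / d + O(1 / n)`. Let `z = exp (i t / s) - 1` and let `N(m)`
  count the small prime divisors. The binomial moments of `N` are sums of such probabilities, and
  `‖1 + z‖ = 1` allows a Bonferroni truncation of `(1 + z) ^ N(m)` at order `½ log log n`: at most
  `O(√n)` errors of size `O(1 / n)` arise, and since `‖z‖` times the mean of `N` is only `O(s)`,
  Rankin's trick makes the discarded terms negligible. So `E (1 + z) ^ N` agrees up to `o(1)` with
  the product of the `1 + z / p`, its value for independent Bernoulli variables
  (`norm_integral_one_add_pow_divisorCount_sub_le`). No moments of the normal law are needed.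
* **The independent model is Gaussian.** As `∑ 1 / p²` converges, the product is
  `exp (z ∑ 1 / p) (1 + o(1))`; over the small primes `∑ 1 / p = s² + o(s)`, again by Mertens, and
  the expansion of `z` to second order gives the limit (`tendsto_prod_one_add_div_mul_exp`).

Mertens' theorems are proved from Legendre's formula for `N!` and Chebyshev's bound.
-/

/-! ### Mertens' theorems -/

theorem log_factorial_eq_sum_primesLE (N : ℕ) :
    Real.log (N.factorial : ℝ)
      = ∑ p ∈ N.primesLE, (N.factorial.factorization p : ℝ) * Real.log p := by
  rw [Real.log_nat_eq_sum_factorization, Finsupp.sum_of_support_subset (s := N.primesLE)]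
  · intro p hp
    rw [Nat.support_factorization, Nat.mem_primeFactors] at hp
    exact Nat.mem_primesLE.2 ⟨hp.1.dvd_factorial.1 hp.2.1, hp.1⟩
  · simp

theorem log_mul_pred_le {p : ℕ} (hp : 2 ≤ p) :
    Real.log p / (p * (p - 1)) ≤ 4 * (1 / (p : ℝ) ^ (3 / 2 : ℝ)) := by
  have hp' : (2 : ℝ) ≤ p := by exact_mod_cast hp
  have h0 : (0 : ℝ) < p := by linarith
  have h1 := Real.log_le_rpow_div h0.le (show (0 : ℝ) < 1 / 2 by norm_num)
  have h2 : (p : ℝ) ^ (3 / 2 : ℝ) * (p : ℝ) ^ (1 / 2 : ℝ) = (p : ℝ) ^ 2 := by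
    rw [← Real.rpow_add h0, ← Real.rpow_natCast]; norm_num
  have h3 : (0 : ℝ) < (p : ℝ) ^ (3 / 2 : ℝ) := by positivity
  rw [mul_one_div, div_le_div_iff₀ (by nlinarith) h3]
  nlinarith [mul_le_mul_of_nonneg_right h1 h3.le]

/-- **Mertens' first theorem.** Legendre's formula sandwiches `log N!` between `N ∑ log p / p` up to
`O(N)`: on one side through `⌊N / p⌋ ≤ v_p(N!)` and Chebyshev's bound for `θ`, on the other
through `v_p(N!) ≤ N / (p - 1)`. -/
theorem exists_abs_sum_log_div_sub_log_le :
    ∃ M : ℝ, ∀ N : ℕ, 1 ≤ N →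
      |∑ p ∈ N.primesLE, Real.log p / p - Real.log N| ≤ M := by
  have hs : Summable fun n : ℕ => 4 * (1 / (n : ℝ) ^ (3 / 2 : ℝ)) :=
    (Real.summable_one_div_nat_rpow.2 (by norm_num)).mul_left 4
  refine ⟨Real.log 4 + 1 + ∑' n : ℕ, 4 * (1 / (n : ℝ) ^ (3 / 2 : ℝ)), fun N hN => ?_⟩
  set c := ∑' n : ℕ, 4 * (1 / (n : ℝ) ^ (3 / 2 : ℝ))
  have hc : 0 ≤ c := tsum_nonneg fun n => by positivity
  have hN0 : (0 : ℝ) < N := by exact_mod_cast hN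
  have hl4 : 0 ≤ Real.log 4 := Real.log_nonneg (by norm_num)
  have hupper : (N : ℝ) * ∑ p ∈ N.primesLE, Real.log p / p ≤ N * Real.log N + Real.log 4 * N := by
    have hθ := Chebyshev.theta_le_log4_mul_x hN0.le
    rw [Chebyshev.theta_eq_sum_primesLE_log] at hθ
    have hfac : Real.log (N.factorial : ℝ) ≤ N * Real.log N := by
      rw [← Real.log_pow]
      exact Real.log_le_log (by exact_mod_cast N.factorial_pos)
        (by exact_mod_cast N.factorial_le_pow)
    rw [log_factorial_eq_sum_primesLE] at hfac
    have : (N : ℝ) * ∑ p ∈ N.primesLE, Real.log p / p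
        ≤ ∑ p ∈ N.primesLE, (N.factorial.factorization p : ℝ) * Real.log p
          + ∑ p ∈ N.primesLE, Real.log p := by
      rw [Finset.mul_sum, ← Finset.sum_add_distrib]
      refine Finset.sum_le_sum fun p hp => ?_
      have hpp := Nat.prime_of_mem_primesLE hp
      have hlog : 0 ≤ Real.log p := Real.log_natCast_nonneg p
      have hfl : N / p ≤ N.factorial.factorization p := by
        rw [Nat.factorization_factorial hpp (b := Nat.log p N + 2) (by omega)]
        refine le_trans (by simp) (Finset.single_le_sum (f := fun i => N / p ^ i)
          (fun i _ => Nat.zero_le _) (Finset.mem_Ico.2 ⟨le_refl 1, by omega⟩))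
      have h1 : (N : ℝ) / p ≤ (N.factorial.factorization p : ℝ) + 1 := by
        have := (Nat.lt_floor_add_one ((N : ℝ) / p)).le
        rw [Nat.floor_div_eq_div] at this
        refine this.trans ?_
        gcongr
      calc (N : ℝ) * (Real.log p / p) = N / p * Real.log p := by ring
        _ ≤ ((N.factorial.factorization p : ℝ) + 1) * Real.log p := by gcongr
        _ = _ := by ring
    linarith
  have hlower : (N : ℝ) * Real.log N - N
      ≤ N * (∑ p ∈ N.primesLE, Real.log p / p + c) := by
    have hfac : (N : ℝ) * Real.log N - N ≤ Real.log (N.factorial : ℝ) := by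
      have h1 := Stirling.le_log_factorial_stirling (n := N) (by omega)
      have h2 : 0 ≤ Real.log N := Real.log_natCast_nonneg N
      have h3 : 0 ≤ Real.log (2 * Real.pi) :=
        Real.log_nonneg (by nlinarith [Real.pi_gt_three])
      linarith
    rw [log_factorial_eq_sum_primesLE] at hfac
    refine hfac.trans ?_
    have h1 : ∑ p ∈ N.primesLE, Real.log p / (p * (p - 1)) ≤ c := by
      refine le_trans (Finset.sum_le_sum fun p hp =>
        log_mul_pred_le (Nat.prime_of_mem_primesLE hp).two_le) ?_
      exact hs.sum_le_tsum _ fun n _ => by positivity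
    calc ∑ p ∈ N.primesLE, (N.factorial.factorization p : ℝ) * Real.log p
        ≤ ∑ p ∈ N.primesLE, N * (Real.log p / p + Real.log p / (p * (p - 1))) := by
          refine Finset.sum_le_sum fun p hp => ?_
          have hpp := Nat.prime_of_mem_primesLE hp
          have hp2 : (2 : ℝ) ≤ p := by exact_mod_cast hpp.two_le
          have hlog : 0 ≤ Real.log p := Real.log_natCast_nonneg p
          have h2 : (N.factorial.factorization p : ℝ) ≤ N / (p - 1) := by
            have h3 : ((N / (p - 1) : ℕ) : ℝ) ≤ N / ((p - 1 : ℕ) : ℝ) := Nat.cast_div_le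
            rw [Nat.cast_sub hpp.one_le, Nat.cast_one] at h3
            refine le_trans ?_ h3
            exact_mod_cast Nat.factorization_factorial_le_div_pred hpp N
          calc (N.factorial.factorization p : ℝ) * Real.log p
              ≤ N / (p - 1) * Real.log p := by gcongr
            _ = N * (Real.log p / p + Real.log p / (p * (p - 1))) := by
              have : (p : ℝ) - 1 ≠ 0 := by linarith
              field_simp
              ring
      _ = N * (∑ p ∈ N.primesLE, Real.log p / p
            + ∑ p ∈ N.primesLE, Real.log p / (p * (p - 1))) := by
          rw [← Finset.sum_add_distrib, Finset.mul_sum]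
      _ ≤ _ := by gcongr
  have hu : ∑ p ∈ N.primesLE, Real.log p / p ≤ Real.log N + Real.log 4 := by
    refine le_of_mul_le_mul_left ?_ hN0
    linarith
  have hl : Real.log N - 1 ≤ ∑ p ∈ N.primesLE, Real.log p / p + c := by
    refine le_of_mul_le_mul_left ?_ hN0
    linarith
  rw [abs_le]
  constructor <;> linarith

theorem sum_primesLE_succ (f : ℕ → ℝ) (n : ℕ) :
    ∑ p ∈ (n + 1).primesLE, f p
      = ∑ p ∈ n.primesLE, f p + if (n + 1).Prime then f (n + 1) else 0 := by
  rw [Nat.primesLE_succ]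
  split_ifs
  · rw [Finset.sum_insert (Nat.notMem_primesLE n), add_comm]
  · simp

/-- **Mertens' second theorem**, with an unspecified bound for the error. Writing `D n` for the
bounded error in the first theorem, the quantity `∑ 1 / p - log log n - D n / log n` changes from
`n` to `n + 1` by at most a constant times `1 / log n - 1 / log (n + 1)`, which telescopes. -/
theorem exists_abs_sum_inv_sub_log_log_le :
    ∃ K : ℝ, 0 ≤ K ∧ ∀ N : ℕ, 2 ≤ N →
      |∑ p ∈ N.primesLE, 1 / (p : ℝ) - Real.log (Real.log N)| ≤ K := by
  obtain ⟨M, hM⟩ := exists_abs_sum_log_div_sub_log_le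
  have hM0 : 0 ≤ M := (abs_nonneg _).trans (hM 1 le_rfl)
  set D : ℕ → ℝ := fun n => ∑ p ∈ n.primesLE, Real.log p / p - Real.log n with hD
  set T : ℕ → ℝ := fun n =>
    ∑ p ∈ n.primesLE, 1 / (p : ℝ) - Real.log (Real.log n) - D n / Real.log n with hT
  have hpos : ∀ n : ℕ, 2 ≤ n → 0 < Real.log n := fun n hn =>
    Real.log_pos (by exact_mod_cast hn)
  have hstep : ∀ n : ℕ, 2 ≤ n →
      |T (n + 1) - T n| ≤ (M + 1) * (1 / Real.log n - 1 / Real.log (n + 1 : ℕ)) := by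
    intro n hn
    have hn0 : (2 : ℝ) ≤ n := by exact_mod_cast hn
    set b := Real.log n with hb
    set a := Real.log (n + 1 : ℕ) with ha
    have hb0 : 0 < b := hpos n hn
    have ha0 : 0 < a := hpos (n + 1) (by omega)
    have hab : b ≤ a := Real.log_le_log (by linarith) (by push_cast; linarith)
    have hab1 : a - b ≤ 1 := by
      rw [ha, hb, ← Real.log_div (by positivity) (by positivity)]
      refine (Real.log_le_sub_one_of_pos (by positivity)).trans ?_
      rw [sub_le_iff_le_add, div_le_iff₀ (by linarith)]
      push_cast
      linarith
    have hTdiff : T (n + 1) - T n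
        = (a - b) / a - (Real.log a - Real.log b) + D n * (1 / b - 1 / a) := by
      simp only [hT, hD]
      rw [sum_primesLE_succ (fun p => 1 / (p : ℝ)), sum_primesLE_succ (fun p => Real.log p / p)]
      rw [← ha, ← hb]
      split_ifs
      · field_simp
        ring
      · field_simp
        ring
    have hlog_lower : (a - b) / a ≤ Real.log a - Real.log b := by
      rw [← Real.log_div ha0.ne' hb0.ne']
      have := Real.one_sub_inv_le_log_of_pos (div_pos ha0 hb0)
      rw [inv_div] at this
      rwa [sub_div, div_self ha0.ne']
    have hlog_upper : Real.log a - Real.log b ≤ (a - b) / b := by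
      rw [← Real.log_div ha0.ne' hb0.ne', sub_div, div_self hb0.ne']
      exact Real.log_le_sub_one_of_pos (div_pos ha0 hb0)
    have hfd : 0 ≤ 1 / b - 1 / a := sub_nonneg.2 (one_div_le_one_div_of_le hb0 hab)
    have hgap : (a - b) / b - (a - b) / a ≤ 1 / b - 1 / a := by
      have : (a - b) / b - (a - b) / a = (a - b) * (1 / b - 1 / a) := by ring
      rw [this]
      exact mul_le_of_le_one_left hfd hab1
    have hDn := abs_le.1 (hM n (by omega))
    have h1 : D n * (1 / b - 1 / a) ≤ M * (1 / b - 1 / a) := by gcongr; exact hDn.2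
    have h2 : -M * (1 / b - 1 / a) ≤ D n * (1 / b - 1 / a) := by gcongr; exact hDn.1
    rw [hTdiff, abs_le]
    constructor <;> linarith
  have htel : ∀ n : ℕ, 2 ≤ n →
      |T n - T 2| ≤ (M + 1) * (1 / Real.log (2 : ℕ) - 1 / Real.log n) := by
    intro n hn
    induction n, hn using Nat.le_induction with
    | base => simp
    | succ n hn ih =>
      have := abs_sub_le (T (n + 1)) (T n) (T 2)
      have := hstep n hn
      linarith
  refine ⟨(M + 1) / Real.log (2 : ℕ) + |T 2| + M / Real.log (2 : ℕ), ?_, fun N hN => ?_⟩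
  · have := hpos 2 le_rfl
    positivity
  · have h1 := htel N hN
    have hN0 := hpos N hN
    have h2 : 0 ≤ (M + 1) * (1 / Real.log N) := by positivity
    have h3 : |D N / Real.log N| ≤ M / Real.log (2 : ℕ) := by
      rw [abs_div, abs_of_pos hN0]
      exact div_le_div₀ hM0 (hM N (by omega)) (hpos 2 le_rfl)
        (Real.log_le_log (by norm_num) (by exact_mod_cast hN))
    have h4 : ∑ p ∈ N.primesLE, 1 / (p : ℝ) - Real.log (Real.log N)
        = (T N - T 2) + T 2 + D N / Real.log N := by simp only [hT]; ring
    rw [h4]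
    refine (abs_add_three _ _ _).trans ?_
    have h5 : (M + 1) * (1 / Real.log (2 : ℕ)) = (M + 1) / Real.log (2 : ℕ) := by ring
    linarith

/-! ### Truncated binomial expansions -/

/-- A Bonferroni-type inequality: for `‖1 + z‖ ≤ 1` the error in truncating the binomial expansion
is at most the first omitted term. -/
theorem norm_one_add_pow_sub_sum_choose_le {z : ℂ} (hz : ‖1 + z‖ ≤ 1) (k r : ℕ) :
    ‖(1 + z) ^ k - ∑ j ∈ Finset.range r, (k.choose j : ℂ) * z ^ j‖ ≤ k.choose r * ‖z‖ ^ r := by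
  induction k generalizing r with
  | zero =>
    cases r with
    | zero => simp
    | succ r => simp [Finset.sum_range_succ']
  | succ k ih =>
    cases r with
    | zero => simpa using pow_le_one₀ (norm_nonneg _) hz
    | succ r =>
      have h : (1 + z) ^ (k + 1)
            - ∑ j ∈ Finset.range (r + 1), ((k + 1).choose j : ℂ) * z ^ j
          = ((1 + z) ^ k - ∑ j ∈ Finset.range (r + 1), (k.choose j : ℂ) * z ^ j)
            + z * ((1 + z) ^ k - ∑ j ∈ Finset.range r, (k.choose j : ℂ) * z ^ j) := by
        rw [Finset.sum_range_succ' _ r, Finset.sum_range_succ' _ r]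
        simp only [Nat.choose_succ_succ, Nat.cast_add, add_mul, Finset.sum_add_distrib,
          Nat.choose_zero_right, mul_sub, Finset.mul_sum]
        rw [show ∑ x ∈ Finset.range r, z * ((k.choose x : ℂ) * z ^ x)
          = ∑ x ∈ Finset.range r, (k.choose x : ℂ) * z ^ (x + 1) from
            Finset.sum_congr rfl fun x _ => by ring]
        ring
      rw [h]
      refine (norm_add_le _ _).trans ?_
      rw [norm_mul]
      have h1 := ih (r + 1)
      have h2 := mul_le_mul_of_nonneg_left (ih r) (norm_nonneg z)
      refine (add_le_add h1 h2).trans (le_of_eq ?_)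
      rw [Nat.choose_succ_succ]
      push_cast
      ring

/-- The sum over the `j`-element subsets of `Q` of the reciprocals of their products: the `j`-th
elementary symmetric function of the numbers `1 / p`, `p ∈ Q`. -/
noncomputable def recipEsymm (Q : Finset ℕ) (j : ℕ) : ℝ :=
  ∑ S ∈ Finset.powersetCard j Q, ∏ p ∈ S, 1 / (p : ℝ)

theorem recipEsymm_nonneg (Q : Finset ℕ) (j : ℕ) : 0 ≤ recipEsymm Q j :=
  Finset.sum_nonneg fun _ _ => Finset.prod_nonneg fun _ _ => by positivity

theorem prod_one_add_div_eq_sum_recipEsymm (Q : Finset ℕ) (z : ℂ) {R : ℕ} (hR : Q.card < R) :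
    ∏ p ∈ Q, (1 + z / p) = ∑ j ∈ Finset.range R, (recipEsymm Q j : ℂ) * z ^ j := by
  rw [Finset.prod_one_add, Finset.sum_powerset]
  have hsub : Finset.range (Q.card + 1) ⊆ Finset.range R := by
    intro j; simp only [Finset.mem_range]; omega
  rw [← Finset.sum_subset hsub]
  · refine Finset.sum_congr rfl fun j _ => ?_
    rw [recipEsymm, Complex.ofReal_sum, Finset.sum_mul]
    refine Finset.sum_congr rfl fun S hS => ?_
    rw [Complex.ofReal_prod, ← (Finset.mem_powersetCard.1 hS).2, ← Finset.prod_const,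
      ← Finset.prod_mul_distrib]
    refine Finset.prod_congr rfl fun p _ => ?_
    push_cast
    ring
  · intro j _ hj
    rw [recipEsymm, Finset.powersetCard_eq_empty.2 (by simpa using hj)]
    simp

/-- Rankin's trick: the terms with `j ≥ r` cost a factor `b ^ r` against the full product. -/
theorem sum_Ico_recipEsymm_mul_pow_le (Q : Finset ℕ) {y b : ℝ} (hy : 0 ≤ y) (hb : 1 ≤ b)
    (r R : ℕ) :
    ∑ j ∈ Finset.Ico r R, recipEsymm Q j * y ^ j
      ≤ Real.exp (b * y * ∑ p ∈ Q, 1 / (p : ℝ)) / b ^ r := by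
  have hb0 : 0 < b := by linarith
  have hprod : ∑ j ∈ Finset.range (R + Q.card + 1), recipEsymm Q j * (b * y) ^ j
      ≤ Real.exp (b * y * ∑ p ∈ Q, 1 / (p : ℝ)) := by
    have h := prod_one_add_div_eq_sum_recipEsymm Q ((b * y : ℝ) : ℂ)
      (R := R + Q.card + 1) (by omega)
    have h' : ∏ p ∈ Q, (1 + b * y / (p : ℝ))
        = ∑ j ∈ Finset.range (R + Q.card + 1), recipEsymm Q j * (b * y) ^ j := by
      exact_mod_cast h
    rw [← h', Finset.mul_sum, Real.exp_sum]
    refine Finset.prod_le_prod (fun p _ => by positivity) fun p _ => ?_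
    have := Real.add_one_le_exp (b * y * (1 / (p : ℝ)))
    rw [mul_one_div] at this ⊢
    linarith
  rw [le_div_iff₀ (by positivity), Finset.sum_mul]
  refine le_trans ?_ hprod
  calc ∑ j ∈ Finset.Ico r R, recipEsymm Q j * y ^ j * b ^ r
      ≤ ∑ j ∈ Finset.Ico r R, recipEsymm Q j * (b * y) ^ j := by
        refine Finset.sum_le_sum fun j hj => ?_
        have hle : b ^ r ≤ b ^ j := pow_le_pow_right₀ hb (Finset.mem_Ico.1 hj).1
        rw [mul_pow, mul_comm (b ^ j), ← mul_assoc]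
        have := recipEsymm_nonneg Q j
        gcongr
    _ ≤ _ := by
        refine Finset.sum_le_sum_of_subset_of_nonneg ?_ fun j _ _ => ?_
        · intro j; simp only [Finset.mem_Ico, Finset.mem_range]; omega
        · have := recipEsymm_nonneg Q j
          positivity

/-- The number of elements of `Q` that divide `m`. -/
def divisorCount (Q : Finset ℕ) (m : ℕ) : ℕ := (Q.filter (· ∣ m)).card

theorem choose_divisorCount (Q : Finset ℕ) (j m : ℕ) :
    ((divisorCount Q m).choose j : ℝ)
      = ∑ S ∈ Finset.powersetCard j Q, {m : ℕ | ∀ p ∈ S, p ∣ m}.indicator 1 m := by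
  classical
  have h : Finset.powersetCard j (Q.filter (· ∣ m))
      = (Finset.powersetCard j Q).filter (fun S => ∀ p ∈ S, p ∣ m) := by
    ext S
    simp only [Finset.mem_powersetCard, Finset.mem_filter, Finset.subset_iff]
    constructor
    · rintro ⟨h1, h2⟩
      exact ⟨⟨fun p hp => (h1 hp).1, h2⟩, fun p hp => (h1 hp).2⟩
    · rintro ⟨⟨h1, h2⟩, h3⟩
      exact ⟨fun p hp => ⟨h1 hp, h3 p hp⟩, h2⟩
  rw [divisorCount, ← Finset.card_powersetCard, h, Finset.card_filter]
  push_cast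
  exact Finset.sum_congr rfl fun S _ => by simp [Set.indicator_apply]

theorem integral_choose_divisorCount (μ : Measure ℕ) [IsFiniteMeasure μ] (Q : Finset ℕ) (j : ℕ) :
    ∫ m, ((divisorCount Q m).choose j : ℝ) ∂μ
      = ∑ S ∈ Finset.powersetCard j Q, μ.real {m | ∀ p ∈ S, p ∣ m} := by
  simp only [choose_divisorCount]
  rw [integral_finsetSum]
  · exact Finset.sum_congr rfl fun S _ => integral_indicator_one (MeasurableSet.of_discrete)
  · exact fun S _ => (integrable_const (1 : ℝ)).indicator MeasurableSet.of_discrete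

theorem divisorCount_le_card (Q : Finset ℕ) (m : ℕ) : divisorCount Q m ≤ Q.card :=
  Finset.card_filter_le _ _

theorem integrable_of_norm_le {μ : Measure ℕ} [IsFiniteMeasure μ] {E : Type*}
    [NormedAddCommGroup E] [MeasurableSpace E] [BorelSpace E] [SecondCountableTopology E]
    (f : ℕ → E) (C : ℝ) (h : ∀ m, ‖f m‖ ≤ C) :
    Integrable f μ :=
  Integrable.of_bound (measurable_from_nat.aestronglyMeasurable) C (ae_of_all _ h)

theorem integrable_choose_divisorCount (μ : Measure ℕ) [IsFiniteMeasure μ] (Q : Finset ℕ) (j : ℕ) :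
    Integrable (fun m => ((divisorCount Q m).choose j : ℝ)) μ := by
  refine integrable_of_norm_le _ (Q.card.choose j : ℝ) fun m => ?_
  rw [Real.norm_natCast]
  exact_mod_cast Nat.choose_le_choose j (divisorCount_le_card Q m)

/-- Comparison of the generating function of `divisorCount Q` under `μ` with that of a sum of
independent Bernoulli variables of parameters `1 / p`, when `μ` gives the multiples of squarefree
products from `Q` nearly their natural mass. The expansion is cut at order `r`, and `b ≥ 1` is a
free parameter in the bound for the discarded terms. -/
theorem norm_integral_one_add_pow_divisorCount_sub_le (μ : Measure ℕ) [IsProbabilityMeasure μ]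
    (Q : Finset ℕ) {δ b : ℝ} (hδ : 0 ≤ δ) (hb : 1 ≤ b)
    (hQ : ∀ S ⊆ Q, |μ.real {m | ∀ p ∈ S, p ∣ m} - ∏ p ∈ S, 1 / (p : ℝ)| ≤ δ)
    {z : ℂ} (hz : ‖1 + z‖ ≤ 1) (r : ℕ) :
    ‖∫ m, (1 + z) ^ divisorCount Q m ∂μ - ∏ p ∈ Q, (1 + z / p)‖
      ≤ δ * ∑ j ∈ Finset.range (r + 1), (Q.card : ℝ) ^ j * ‖z‖ ^ j
        + 2 * (Real.exp (b * ‖z‖ * ∑ p ∈ Q, 1 / (p : ℝ)) / b ^ r) := by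
  set E : ℕ → ℝ := fun j => ∫ m, ((divisorCount Q m).choose j : ℝ) ∂μ with hE
  have hEe : ∀ j, |E j - recipEsymm Q j| ≤ δ * (Q.card : ℝ) ^ j := by
    intro j
    simp only [hE, integral_choose_divisorCount, recipEsymm]
    rw [← Finset.sum_sub_distrib]
    refine (Finset.abs_sum_le_sum_abs _ _).trans ?_
    refine (Finset.sum_le_card_nsmul _ _ δ fun S hS =>
      hQ S (Finset.mem_powersetCard.1 hS).1).trans ?_
    rw [Finset.card_powersetCard, nsmul_eq_mul, mul_comm]
    gcongr
    exact_mod_cast Nat.choose_le_pow _ _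
  have hint : ∀ j, Integrable (fun m => ((divisorCount Q m).choose j : ℂ) * z ^ j) μ := by
    intro j
    have := (integrable_choose_divisorCount μ Q j).ofReal (𝕜 := ℂ)
    simpa using this.mul_const (z ^ j)
  have hfull : Integrable (fun m => (1 + z) ^ divisorCount Q m) μ := by
    refine integrable_of_norm_le _ 1 fun m => ?_
    rw [norm_pow]
    exact pow_le_one₀ (norm_nonneg _) hz
  have hEc : ∀ j, ∫ m, ((divisorCount Q m).choose j : ℂ) * z ^ j ∂μ = (E j : ℂ) * z ^ j := by
    intro j
    rw [integral_mul_const, hE]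
    congr 1
    simpa using integral_ofReal (μ := μ) (𝕜 := ℂ)
      (f := fun m => ((divisorCount Q m).choose j : ℝ))
  have h1 : ‖∫ m, (1 + z) ^ divisorCount Q m ∂μ - ∑ j ∈ Finset.range r, (E j : ℂ) * z ^ j‖
      ≤ E r * ‖z‖ ^ r := by
    rw [← Finset.sum_congr rfl fun j _ => hEc j, ← integral_finsetSum _ fun j _ => hint j,
      ← integral_sub hfull (integrable_finsetSum _ fun j _ => hint j), hE]
    simp only
    rw [← integral_mul_const]
    exact norm_integral_le_of_norm_le ((integrable_choose_divisorCount μ Q r).mul_const _)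
      (ae_of_all _ fun m => norm_one_add_pow_sub_sum_choose_le hz _ _)
  set R := Q.card + r + 1
  have hmodel : ∏ p ∈ Q, (1 + z / p)
      = ∑ j ∈ Finset.range r, (recipEsymm Q j : ℂ) * z ^ j
        + ∑ j ∈ Finset.Ico r R, (recipEsymm Q j : ℂ) * z ^ j := by
    rw [prod_one_add_div_eq_sum_recipEsymm Q z (R := R) (by omega),
      Finset.sum_range_add_sum_Ico _ (by omega)]
  have h2 : ‖∑ j ∈ Finset.range r, (E j : ℂ) * z ^ j
        - ∑ j ∈ Finset.range r, (recipEsymm Q j : ℂ) * z ^ j‖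
      ≤ δ * ∑ j ∈ Finset.range r, (Q.card : ℝ) ^ j * ‖z‖ ^ j := by
    rw [← Finset.sum_sub_distrib, Finset.mul_sum]
    refine norm_sum_le_of_le _ fun j _ => ?_
    rw [← sub_mul, norm_mul, norm_pow, ← Complex.ofReal_sub, Complex.norm_real, Real.norm_eq_abs,
      ← mul_assoc]
    exact mul_le_mul_of_nonneg_right (hEe j) (by positivity)
  have h3 : ‖∑ j ∈ Finset.Ico r R, (recipEsymm Q j : ℂ) * z ^ j‖
      ≤ Real.exp (b * ‖z‖ * ∑ p ∈ Q, 1 / (p : ℝ)) / b ^ r := by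
    refine le_trans ?_ (sum_Ico_recipEsymm_mul_pow_le Q (norm_nonneg z) hb r R)
    refine norm_sum_le_of_le _ fun j _ => ?_
    rw [norm_mul, norm_pow, Complex.norm_real, Real.norm_eq_abs,
      abs_of_nonneg (recipEsymm_nonneg Q j)]
  have h4 : E r * ‖z‖ ^ r ≤ δ * ((Q.card : ℝ) ^ r * ‖z‖ ^ r)
      + Real.exp (b * ‖z‖ * ∑ p ∈ Q, 1 / (p : ℝ)) / b ^ r := by
    have h5 := sum_Ico_recipEsymm_mul_pow_le Q (norm_nonneg z) hb r (r + 1)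
    rw [Nat.Ico_succ_singleton, Finset.sum_singleton] at h5
    have h6 : E r ≤ δ * (Q.card : ℝ) ^ r + recipEsymm Q r := by
      linarith [(abs_le.1 (hEe r)).2]
    have h7 := mul_le_mul_of_nonneg_right h6 (pow_nonneg (norm_nonneg z) r)
    linarith
  rw [hmodel, Finset.sum_range_succ, mul_add]
  set A := ∫ m, (1 + z) ^ divisorCount Q m ∂μ
  set B := ∑ j ∈ Finset.range r, (E j : ℂ) * z ^ j
  set C := ∑ j ∈ Finset.range r, (recipEsymm Q j : ℂ) * z ^ j
  set F := ∑ j ∈ Finset.Ico r R, (recipEsymm Q j : ℂ) * z ^ j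
  have h8 : A - (C + F) = (A - B) + (B - C) - F := by ring
  rw [h8]
  refine (norm_sub_le _ _).trans ?_
  have := norm_add_le (A - B) (B - C)
  linarith

/-! ### The generating function of the independent model -/

theorem exists_norm_prod_one_add_div_mul_exp_sub_one_le :
    ∃ c : ℝ, ∀ (Q : Finset ℕ) (z : ℂ), (∀ p ∈ Q, 1 ≤ p) → ‖z‖ ≤ 1 →
      ‖(∏ p ∈ Q, (1 + z / p)) * Complex.exp (-(z * (∑ p ∈ Q, 1 / (p : ℝ) : ℝ))) - 1‖
        ≤ Real.exp (c * ‖z‖ ^ 2) - 1 := by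
  have hs : Summable fun n : ℕ => 1 / (n : ℝ) ^ 2 := Real.summable_one_div_nat_pow.2 (by norm_num)
  refine ⟨Real.exp 1 * ∑' n : ℕ, 1 / (n : ℝ) ^ 2, fun Q z hQ hz => ?_⟩
  have hexp : Complex.exp (-(z * (∑ p ∈ Q, 1 / (p : ℝ) : ℝ)))
      = ∏ p ∈ Q, Complex.exp (-(z / p)) := by
    rw [← Complex.exp_sum, Finset.sum_neg_distrib]
    push_cast
    rw [Finset.mul_sum]
    simp only [mul_one_div]
  have hprod : (∏ p ∈ Q, (1 + z / p)) * Complex.exp (-(z * (∑ p ∈ Q, 1 / (p : ℝ) : ℝ)))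
      = ∏ p ∈ Q, (1 + ((1 + z / p) * Complex.exp (-(z / p)) - 1)) := by
    rw [hexp, ← Finset.prod_mul_distrib]
    exact Finset.prod_congr rfl fun p _ => by ring
  rw [hprod]
  refine (Finset.norm_prod_one_add_sub_one_le Q _).trans ?_
  gcongr
  have hterm : ∀ p ∈ Q, ‖(1 + z / p) * Complex.exp (-(z / p)) - 1‖
      ≤ Real.exp 1 * ‖z‖ ^ 2 * (1 / (p : ℝ) ^ 2) := by
    intro p hp
    have hp1 : (1 : ℝ) ≤ p := by exact_mod_cast hQ p hp
    have hw : ‖z / p‖ ≤ 1 := by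
      rw [norm_div, Complex.norm_natCast]
      exact div_le_one_of_le₀ (hz.trans hp1) (by positivity)
    have h1 : (1 + z / p) * Complex.exp (-(z / p)) - 1
        = -(Complex.exp (-(z / p)) * (Complex.exp (z / p) - 1 - z / p)) := by
      have : Complex.exp (-(z / p)) * Complex.exp (z / p) = 1 := by
        rw [← Complex.exp_add]; simp
      linear_combination this
    rw [h1, norm_neg, norm_mul]
    have h2 : ‖Complex.exp (-(z / p))‖ ≤ Real.exp 1 := by
      refine (Complex.norm_exp_le_exp_norm _).trans ?_
      rw [norm_neg]
      exact Real.exp_le_exp.2 hw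
    have h3 := Complex.norm_exp_sub_one_sub_id_le hw
    refine (mul_le_mul h2 h3 (norm_nonneg _) (Real.exp_pos 1).le).trans (le_of_eq ?_)
    rw [norm_div, Complex.norm_natCast]
    ring
  refine (Finset.sum_le_sum hterm).trans ?_
  rw [← Finset.mul_sum]
  have := hs.sum_le_tsum Q fun n _ => by positivity
  calc Real.exp 1 * ‖z‖ ^ 2 * ∑ p ∈ Q, 1 / (p : ℝ) ^ 2
      ≤ Real.exp 1 * ‖z‖ ^ 2 * ∑' n : ℕ, 1 / (n : ℝ) ^ 2 := by gcongr
    _ = _ := by ring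

theorem norm_exp_ofReal_mul_I_sub_one_le (u : ℝ) : ‖Complex.exp (u * Complex.I) - 1‖ ≤ |u| := by
  rw [mul_comm]
  exact Real.norm_exp_I_mul_ofReal_sub_one_le

theorem tendsto_div_sq_of_tendsto_sub_sq_div {s L : ℕ → ℝ} (hs : Tendsto s atTop atTop)
    (hL : Tendsto (fun n => (L n - s n ^ 2) / s n) atTop (𝓝 0)) :
    Tendsto (fun n => L n / s n ^ 2) atTop (𝓝 1) := by
  have h : Tendsto (fun n => (L n - s n ^ 2) / s n * (s n)⁻¹ + 1) atTop (𝓝 (0 * 0 + 1)) :=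
    (hL.mul hs.inv_tendsto_atTop).add_const 1
  rw [zero_mul, zero_add] at h
  refine h.congr' ?_
  filter_upwards [hs.eventually_gt_atTop 0] with n hn
  field_simp
  ring

theorem tendsto_exp_sub_one_mul_sub {s L : ℕ → ℝ} (hs : Tendsto s atTop atTop)
    (hL : Tendsto (fun n => (L n - s n ^ 2) / s n) atTop (𝓝 0)) (t : ℝ) :
    Tendsto (fun n => (Complex.exp ((t / s n : ℝ) * Complex.I) - 1) * (L n : ℂ)
      - (t / s n : ℝ) * Complex.I * ((s n ^ 2 : ℝ) : ℂ)) atTop (𝓝 (-(t ^ 2 / 2 : ℝ) : ℂ)) := by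
  have hratio := tendsto_div_sq_of_tendsto_sub_sq_div hs hL
  have hu : Tendsto (fun n => t / s n) atTop (𝓝 0) := hs.const_div_atTop t
  have hcube : Tendsto (fun n => (Complex.exp ((t / s n : ℝ) * Complex.I)
      - ∑ m ∈ Finset.range 3, ((t / s n : ℝ) * Complex.I) ^ m / (m.factorial : ℂ)) * (L n : ℂ))
      atTop (𝓝 0) := by
    have hbound : Tendsto (fun n => |t / s n| * Real.exp |t / s n| * t ^ 2 * |L n / s n ^ 2|)
        atTop (𝓝 (|0| * Real.exp |0| * t ^ 2 * |1|)) :=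
      ((hu.abs.mul ((Real.continuous_exp.tendsto _).comp hu.abs)).mul_const _).mul hratio.abs
    rw [abs_zero, zero_mul, zero_mul, zero_mul] at hbound
    refine squeeze_zero_norm' ?_ hbound
    filter_upwards [hs.eventually_gt_atTop 0] with n hn
    rw [norm_mul, Complex.norm_real, Real.norm_eq_abs]
    have h := Complex.norm_exp_sub_sum_le_norm_mul_exp ((t / s n : ℝ) * Complex.I) 3
    rw [norm_mul, Complex.norm_I, mul_one, Complex.norm_real, Real.norm_eq_abs] at h
    refine (mul_le_mul_of_nonneg_right h (abs_nonneg _)).trans (le_of_eq ?_)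
    rw [abs_div (L n), abs_of_pos (pow_pos hn 2), abs_div t, abs_of_pos hn, div_pow, ← sq_abs t]
    field_simp
  have hmean : Tendsto (fun n => ((t * ((L n - s n ^ 2) / s n) : ℝ) : ℂ) * Complex.I)
      atTop (𝓝 ((t * 0 : ℝ) * Complex.I)) :=
    ((Complex.continuous_ofReal.tendsto _).comp (hL.const_mul t)).mul_const _
  have hvar : Tendsto (fun n => ((-(t ^ 2 / 2) * (L n / s n ^ 2) : ℝ) : ℂ))
      atTop (𝓝 ((-(t ^ 2 / 2) * 1 : ℝ) : ℂ)) :=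
    (Complex.continuous_ofReal.tendsto _).comp (hratio.const_mul _)
  have h := (hcube.add hvar).add hmean
  refine (h.congr' ?_).trans (le_of_eq ?_)
  · filter_upwards [hs.eventually_gt_atTop 0] with n hn
    have hn' : (s n : ℂ) ≠ 0 := by exact_mod_cast hn.ne'
    simp only [Finset.sum_range_succ, Finset.sum_range_zero, Nat.factorial]
    push_cast
    field_simp
    rw [Complex.I_sq]
    ring
  · simp

/-- The characteristic function of the normalized sum of independent Bernoulli variables of
parameters `1 / p`, `p ∈ Q n`, centred at `s n ^ 2` and scaled by `s n`, converges to the Gaussian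
one as soon as the mean is `s n ^ 2 + o(s n)`. -/
theorem tendsto_prod_one_add_div_mul_exp {s : ℕ → ℝ} {Q : ℕ → Finset ℕ}
    (hs : Tendsto s atTop atTop) (hQ : ∀ n, ∀ p ∈ Q n, 1 ≤ p)
    (hL : Tendsto (fun n => (∑ p ∈ Q n, 1 / (p : ℝ) - s n ^ 2) / s n) atTop (𝓝 0)) (t : ℝ) :
    Tendsto (fun n => (∏ p ∈ Q n, (1 + (Complex.exp ((t / s n : ℝ) * Complex.I) - 1) / p))
      * Complex.exp (-((t / s n : ℝ) * Complex.I * ((s n ^ 2 : ℝ) : ℂ)))) atTop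
      (𝓝 (Complex.exp (-(t ^ 2 / 2 : ℝ) : ℂ))) := by
  obtain ⟨c, hc⟩ := exists_norm_prod_one_add_div_mul_exp_sub_one_le
  have hu : Tendsto (fun n => t / s n) atTop (𝓝 0) := hs.const_div_atTop t
  have hz : Tendsto (fun n => ‖Complex.exp ((t / s n : ℝ) * Complex.I) - 1‖) atTop (𝓝 0) :=
    squeeze_zero (fun _ => norm_nonneg _) (fun n => norm_exp_ofReal_mul_I_sub_one_le _)
      (by simpa using hu.abs)
  have h1 : Tendsto (fun n =>
      (∏ p ∈ Q n, (1 + (Complex.exp ((t / s n : ℝ) * Complex.I) - 1) / p))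
      * Complex.exp (-((Complex.exp ((t / s n : ℝ) * Complex.I) - 1)
          * (∑ p ∈ Q n, 1 / (p : ℝ) : ℝ)))) atTop (𝓝 1) := by
    rw [tendsto_iff_norm_sub_tendsto_zero]
    have hb : Tendsto (fun n => Real.exp (c * ‖Complex.exp ((t / s n : ℝ) * Complex.I) - 1‖ ^ 2)
        - 1) atTop (𝓝 (Real.exp (c * 0 ^ 2) - 1)) :=
      ((Real.continuous_exp.tendsto _).comp ((hz.pow 2).const_mul c)).sub_const 1
    have h0 : Real.exp (c * 0 ^ 2) - 1 = 0 := by simp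
    rw [h0] at hb
    refine squeeze_zero' (Eventually.of_forall fun _ => norm_nonneg _) ?_ hb
    filter_upwards [hz.eventually_le_const one_pos] with n hn
    exact hc (Q n) _ (hQ n) hn
  have h2 := h1.mul ((Complex.continuous_exp.tendsto _).comp (tendsto_exp_sub_one_mul_sub hs hL t))
  rw [one_mul] at h2
  refine h2.congr fun n => ?_
  rw [Function.comp_apply, mul_assoc, ← Complex.exp_add]
  congr 2
  ring

/-! ### Distributions close to the uniform one on multiples -/

/-- Under a measure on `{1, …, n}` with point masses `1 / n + e i`, the multiples of `d` have mass
`⌊n / d⌋ / n + ∑ e (l d)`. -/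
theorem measureReal_dvd_eq {μ : Measure ℕ} [IsFiniteMeasure μ] {n : ℕ}
    (hsupp : μ (Set.Icc 1 n)ᶜ = 0) {e : ℕ → ℝ}
    (he : ∀ i ∈ Set.Icc 1 n, μ.real {i} = 1 / (n : ℝ) + e i) {d : ℕ} (hd : 0 < d) :
    μ.real {m | d ∣ m} = (n / d : ℕ) / (n : ℝ) + ∑ l ∈ Finset.Icc 1 (n / d), e (l * d) := by
  have hset : ({m | d ∣ m} : Set ℕ) ∩ Set.Icc 1 n
      = (((Finset.Icc 1 (n / d)).image (· * d) : Finset ℕ) : Set ℕ) := by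
    ext m
    simp only [Set.mem_inter_iff, Set.mem_ofPred_eq, Set.mem_Icc, Finset.coe_image,
      Finset.coe_Icc, Set.mem_image]
    constructor
    · rintro ⟨⟨l, rfl⟩, h1, h2⟩
      refine ⟨l, ⟨Nat.pos_of_ne_zero ?_, ?_⟩, mul_comm _ _⟩
      · rintro rfl; simp at h1
      · rw [Nat.le_div_iff_mul_le hd, mul_comm]; exact h2
    · rintro ⟨l, ⟨h1, h2⟩, rfl⟩
      exact ⟨dvd_mul_left _ _, Nat.mul_pos h1 hd, (Nat.le_div_iff_mul_le hd).1 h2⟩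
  have h1 : μ.real {m | d ∣ m} = μ.real ({m | d ∣ m} ∩ Set.Icc 1 n) := by
    simp only [measureReal_def]
    rw [measure_inter_conull hsupp]
  rw [h1, hset, ← sum_measureReal_singleton, Finset.sum_image]
  · rw [Finset.sum_congr rfl fun l hl => he (l * d) ?_, Finset.sum_add_distrib]
    · simp [div_eq_mul_inv]
    · rw [Finset.mem_Icc] at hl
      exact ⟨Nat.mul_pos hl.1 hd, (Nat.le_div_iff_mul_le hd).1 hl.2⟩
  · intro a _ b _ hab
    exact Nat.eq_of_mul_eq_mul_right hd hab

theorem setOf_forall_dvd_eq {S : Finset ℕ} (hS : ∀ p ∈ S, p.Prime) :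
    {m : ℕ | ∀ p ∈ S, p ∣ m} = {m | ∏ p ∈ S, p ∣ m} := by
  ext m
  exact ⟨fun h => Finset.prod_primes_dvd m (fun p hp => (hS p hp).prime) h,
    fun h p hp => (Finset.dvd_prod_of_mem (fun p => p) hp).trans h⟩

theorem abs_natDiv_div_sub_inv_le {n d : ℕ} (hn : 0 < n) :
    |((n / d : ℕ) : ℝ) / n - 1 / d| ≤ 1 / n := by
  have hn' : (0 : ℝ) < n := by exact_mod_cast hn
  have h1 : ((n / d : ℕ) : ℝ) ≤ n / d := Nat.cast_div_le
  have h2 : (n : ℝ) / d ≤ ((n / d : ℕ) : ℝ) + 1 := by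
    have := (Nat.lt_floor_add_one ((n : ℝ) / d)).le
    rwa [Nat.floor_div_eq_div] at this
  have h3 : ((n / d : ℕ) : ℝ) / n - 1 / d = (((n / d : ℕ) : ℝ) - n / d) / n := by
    field_simp
  rw [h3, abs_div, abs_of_pos hn']
  gcongr
  rw [abs_le]
  constructor <;> linarith

/-- If the deviations `e` sum to `O(1 / n)` along the multiples of every product of distinct primes
up to `y`, then such a product divides a random integer with probability `1 / d + O(1 / n)`. -/
theorem abs_measureReal_forall_dvd_sub_prod_le {μ : Measure ℕ} [IsProbabilityMeasure μ] {n : ℕ}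
    (hn : 1 ≤ n) (hsupp : μ (Set.Icc 1 n)ᶜ = 0) {e : ℕ → ℝ}
    (he : ∀ i ∈ Set.Icc 1 n, μ.real {i} = 1 / (n : ℝ) + e i) {y D : ℝ}
    (hsmall : ∀ k : ℕ, 1 ≤ k → ∀ p : Fin k → ℕ, Function.Injective p → (∀ j, (p j).Prime) →
      (∀ j, (p j : ℝ) ≤ y) →
        0 ≤ ∑ l ∈ Finset.Icc 1 (n / ∏ j, p j), e (l * ∏ j, p j) ∧
        ∑ l ∈ Finset.Icc 1 (n / ∏ j, p j), e (l * ∏ j, p j) ≤ D / (n : ℝ))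
    {S : Finset ℕ} (hS : ∀ p ∈ S, p.Prime) (hSy : ∀ p ∈ S, (p : ℝ) ≤ y) :
    |μ.real {m | ∀ p ∈ S, p ∣ m} - ∏ p ∈ S, 1 / (p : ℝ)| ≤ (1 + |D|) / n := by
  have hn' : (0 : ℝ) < n := by exact_mod_cast hn
  rcases S.eq_empty_or_nonempty with rfl | hne
  · simp
    positivity
  · have hpos : 0 < ∏ p ∈ S, p := Finset.prod_pos fun p hp => (hS p hp).pos
    have hprod : ∏ j, ((S.equivFin.symm j : S) : ℕ) = ∏ p ∈ S, p := by
      rw [Equiv.prod_comp S.equivFin.symm (fun p : S => (p : ℕ))]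
      exact Finset.prod_coe_sort S fun p => p
    obtain ⟨h0, hD⟩ := hsmall S.card hne.card_pos (fun j => ((S.equivFin.symm j : S) : ℕ))
      (Subtype.val_injective.comp S.equivFin.symm.injective)
      (fun j => hS _ (S.equivFin.symm j).2) (fun j => hSy _ (S.equivFin.symm j).2)
    rw [hprod] at h0 hD
    rw [setOf_forall_dvd_eq hS, measureReal_dvd_eq hsupp he hpos, Finset.prod_div_distrib,
      Finset.prod_const_one, ← Nat.cast_prod, add_sub_right_comm, add_div]
    refine (abs_add_le _ _).trans (add_le_add (abs_natDiv_div_sub_inv_le hn) ?_)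
    rw [abs_of_nonneg h0]
    refine hD.trans ?_
    gcongr
    exact le_abs_self D

theorem cardDistinctFactors_eq_divisorCount {m n : ℕ} (hm : m ∈ Set.Icc 1 n) :
    ArithmeticFunction.cardDistinctFactors m = divisorCount n.primesLE m := by
  rw [ArithmeticFunction.cardDistinctFactors_apply, divisorCount]
  change m.primeFactors.card = _
  congr 1
  ext p
  simp only [Nat.mem_primeFactors, Finset.mem_filter, Nat.mem_primesLE]
  constructor
  · rintro ⟨h1, h2, h3⟩
    exact ⟨⟨(Nat.le_of_dvd hm.1 h2).trans hm.2, h1⟩, h2⟩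
  · rintro ⟨⟨h1, h2⟩, h3⟩
    exact ⟨h2, h3, by have := hm.1; omega⟩

theorem divisorCount_add_sdiff {Q Q' : Finset ℕ} (h : Q ⊆ Q') (m : ℕ) :
    divisorCount Q m + divisorCount (Q' \ Q) m = divisorCount Q' m := by
  rw [divisorCount, divisorCount, divisorCount, ← Finset.card_union_of_disjoint,
    ← Finset.filter_union, Finset.union_sdiff_of_subset h]
  exact Finset.disjoint_filter_filter Finset.disjoint_sdiff

theorem integral_divisorCount (μ : Measure ℕ) [IsFiniteMeasure μ] (Q : Finset ℕ) :
    ∫ m, (divisorCount Q m : ℝ) ∂μ = ∑ p ∈ Q, μ.real {m | p ∣ m} := by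
  have := integral_choose_divisorCount μ Q 1
  simpa [Finset.powersetCard_one] using this

theorem integrable_divisorCount (μ : Measure ℕ) [IsFiniteMeasure μ] (Q : Finset ℕ) :
    Integrable (fun m => (divisorCount Q m : ℝ)) μ := by
  simpa using integrable_choose_divisorCount μ Q 1

/-- Primes along whose multiples the deviations sum to at most `C / p` contribute on average no more
than a constant times the sum of their reciprocals. -/
theorem integral_divisorCount_le {μ : Measure ℕ} [IsFiniteMeasure μ] {n : ℕ}
    (hn : 1 ≤ n) (hsupp : μ (Set.Icc 1 n)ᶜ = 0) {e : ℕ → ℝ}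
    (he : ∀ i ∈ Set.Icc 1 n, μ.real {i} = 1 / (n : ℝ) + e i) {C : ℝ} {Q : Finset ℕ}
    (hQ : ∀ p ∈ Q, p.Prime)
    (hlarge : ∀ p ∈ Q, ∑ l ∈ Finset.Icc 1 (n / p), e (l * p) ≤ C / (p : ℝ)) :
    ∫ m, (divisorCount Q m : ℝ) ∂μ ≤ (1 + |C|) * ∑ p ∈ Q, 1 / (p : ℝ) := by
  have hn' : (0 : ℝ) < n := by exact_mod_cast hn
  rw [integral_divisorCount, Finset.mul_sum]
  refine Finset.sum_le_sum fun p hp => ?_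
  have hp0 : (0 : ℝ) < p := by exact_mod_cast (hQ p hp).pos
  rw [measureReal_dvd_eq hsupp he (hQ p hp).pos]
  have h1 : ((n / p : ℕ) : ℝ) / n ≤ 1 / p := by
    rw [div_le_iff₀ hn', one_div_mul_eq_div]
    exact Nat.cast_div_le
  have h2 : C / p ≤ |C| * (1 / p) := by
    rw [mul_one_div]
    gcongr
    exact le_abs_self C
  linarith [hlarge p hp]

/-! ### Primes up to the truncation point -/

/-- The primes up to `n ^ (1 / log log n)`. -/
noncomputable def smallPrimes (n : ℕ) : Finset ℕ :=
  ⌊(n : ℝ) ^ (1 / Real.log (Real.log n))⌋₊.primesLE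

theorem tendsto_log_natCast_atTop : Tendsto (fun n : ℕ => Real.log n) atTop atTop :=
  Real.tendsto_log_atTop.comp tendsto_natCast_atTop_atTop

theorem tendsto_log_log_natCast_atTop :
    Tendsto (fun n : ℕ => Real.log (Real.log n)) atTop atTop :=
  Real.tendsto_log_atTop.comp tendsto_log_natCast_atTop

theorem tendsto_log_div_log_log_atTop :
    Tendsto (fun n : ℕ => Real.log n / Real.log (Real.log n)) atTop atTop := by
  have h := (Real.isLittleO_log_id_atTop.comp_tendsto tendsto_log_natCast_atTop).tendsto_div_nhds_zero
  have h' : Tendsto (fun n : ℕ => Real.log (Real.log n) / Real.log n) atTop (𝓝[>] 0) := by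
    refine tendsto_nhdsWithin_iff.2 ⟨h, ?_⟩
    filter_upwards [tendsto_log_natCast_atTop.eventually_gt_atTop 0,
      tendsto_log_log_natCast_atTop.eventually_gt_atTop 0] with n h1 h2
    exact div_pos h2 h1
  refine h'.inv_tendsto_nhdsGT_zero.congr fun n => ?_
  simp

theorem eventually_smallPrimes_subset : ∀ᶠ n : ℕ in atTop, smallPrimes n ⊆ n.primesLE := by
  filter_upwards [tendsto_log_log_natCast_atTop.eventually_ge_atTop 1,
    eventually_ge_atTop 1] with n hn hn1
  refine Nat.primesLE_mono (Nat.floor_le_of_le ?_)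
  have h1 : (1 : ℝ) ≤ n := by exact_mod_cast hn1
  calc (n : ℝ) ^ (1 / Real.log (Real.log n)) ≤ (n : ℝ) ^ (1 : ℝ) :=
        Real.rpow_le_rpow_of_exponent_le h1 ((div_le_one (by linarith)).2 hn)
    _ = n := Real.rpow_one _

/-- Lowering the cut-off from `n` to `n ^ (1 / log log n)` changes the sum of the reciprocals of
the primes by `O(log log log n)` only. -/
theorem exists_eventually_abs_sum_smallPrimes_sub_le :
    ∃ K : ℝ, ∀ᶠ n : ℕ in atTop,
      |∑ p ∈ smallPrimes n, 1 / (p : ℝ) - Real.log (Real.log n)|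
        ≤ K + Real.log (Real.log (Real.log n)) ∧
      ∑ p ∈ n.primesLE \ smallPrimes n, 1 / (p : ℝ)
        ≤ K + Real.log (Real.log (Real.log n)) := by
  obtain ⟨K, hK0, hK⟩ := exists_abs_sum_inv_sub_log_log_le
  refine ⟨2 * K + Real.log 2, ?_⟩
  have hl2 : 0 < Real.log 2 := Real.log_pos (by norm_num)
  filter_upwards [tendsto_log_log_natCast_atTop.eventually_ge_atTop 1,
    tendsto_log_div_log_log_atTop.eventually_ge_atTop (2 * Real.log 2),
    tendsto_log_natCast_atTop.eventually_gt_atTop 0,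
    eventually_ge_atTop 2, eventually_smallPrimes_subset] with n hLL hα hlog hn hsub
  have hn0 : (0 : ℝ) < n := by positivity
  set LL := Real.log (Real.log n) with hLLdef
  set α := (n : ℝ) ^ (1 / LL) with hαdef
  have hα0 : 0 < α := Real.rpow_pos_of_pos hn0 _
  have hlogα : Real.log α = Real.log n / LL := by
    rw [hαdef, Real.log_rpow hn0]; ring
  rw [← hlogα] at hα
  have hα4 : 4 ≤ α := by
    rw [← Real.exp_log hα0, show (4 : ℝ) = Real.exp (2 * Real.log 2) by
      rw [mul_comm, Real.exp_mul, Real.exp_log (by norm_num)]; norm_num]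
    exact Real.exp_le_exp.2 hα
  set N := ⌊α⌋₊ with hN
  have hN2 : 2 ≤ N := Nat.le_floor (by push_cast; linarith)
  have hNα : (N : ℝ) ≤ α := Nat.floor_le hα0.le
  have hαN : α ≤ 2 * N := by
    have h1 := Nat.lt_floor_add_one α
    have h2 : (2 : ℝ) ≤ N := by exact_mod_cast hN2
    linarith
  have hN0 : (0 : ℝ) < N := by positivity
  have hlogN0 : 0 < Real.log N := Real.log_pos (by exact_mod_cast hN2)
  have hloglogα : Real.log (Real.log α) = LL - Real.log LL := by
    rw [hlogα, Real.log_div hlog.ne' (by linarith)]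
  have hup : Real.log (Real.log N) ≤ LL - Real.log LL := by
    rw [← hloglogα]
    exact Real.log_le_log hlogN0 (Real.log_le_log hN0 hNα)
  have hlow : LL - Real.log LL - Real.log 2 ≤ Real.log (Real.log N) := by
    have h1 : Real.log α / 2 ≤ Real.log N := by
      have := Real.log_le_log hα0 hαN
      rw [Real.log_mul (by norm_num) hN0.ne'] at this
      linarith
    have h2 := Real.log_le_log (by linarith) h1
    rwa [Real.log_div (by linarith) (by norm_num), hloglogα] at h2
  have hlogLL : 0 ≤ Real.log LL := Real.log_nonneg hLL
  have hKN := abs_le.1 (hK N hN2)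
  have hKn := abs_le.1 (hK n hn)
  have hsmall : ∑ p ∈ smallPrimes n, 1 / (p : ℝ) = ∑ p ∈ N.primesLE, 1 / (p : ℝ) := rfl
  refine ⟨?_, ?_⟩
  · rw [hsmall, abs_le]
    constructor <;> linarith
  · have := Finset.sum_sdiff (f := fun p : ℕ => 1 / (p : ℝ)) hsub
    linarith [hKn.2, hKN.1]

theorem tendsto_const_add_log_div_sqrt (K : ℝ) :
    Tendsto (fun n : ℕ => (K + Real.log (Real.log (Real.log n))) / √(Real.log (Real.log n)))
      atTop (𝓝 0) := by
  have h1 : Tendsto (fun x : ℝ => Real.log x / √x) atTop (𝓝 0) := by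
    have := (isLittleO_log_rpow_atTop (r := 1 / 2) (by norm_num)).tendsto_div_nhds_zero
    simpa [Real.sqrt_eq_rpow] using this
  have h2 : Tendsto (fun x : ℝ => K / √x) atTop (𝓝 0) :=
    Real.tendsto_sqrt_atTop.const_div_atTop K
  have h3 := (h2.add h1).comp tendsto_log_log_natCast_atTop
  rw [add_zero] at h3
  exact h3.congr fun n => by simp [add_div]

theorem tendsto_sqrt_log_log_atTop :
    Tendsto (fun n : ℕ => √(Real.log (Real.log n))) atTop atTop :=
  Real.tendsto_sqrt_atTop.comp tendsto_log_log_natCast_atTop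

theorem tendsto_sum_smallPrimes_sub_div_sqrt :
    Tendsto (fun n : ℕ => (∑ p ∈ smallPrimes n, 1 / (p : ℝ) - √(Real.log (Real.log n)) ^ 2)
      / √(Real.log (Real.log n))) atTop (𝓝 0) := by
  obtain ⟨K, hK⟩ := exists_eventually_abs_sum_smallPrimes_sub_le
  refine squeeze_zero_norm' ?_ (tendsto_const_add_log_div_sqrt K)
  filter_upwards [hK, tendsto_log_log_natCast_atTop.eventually_gt_atTop 0] with n hn hpos
  rw [Real.sq_sqrt hpos.le, norm_div, Real.norm_eq_abs, Real.norm_eq_abs,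
    abs_of_nonneg (Real.sqrt_nonneg _)]
  gcongr
  exact hn.1

/-- Cutting the expansion at order `½ log log n` keeps the number of terms below `√n`, up to a
constant. -/
theorem sum_card_smallPrimes_pow_le {n : ℕ} (hn : 3 ≤ n) (hLL : 0 < Real.log (Real.log n)) {x : ℝ}
    (hx0 : 0 ≤ x) (hx : x ≤ 1 / 2) :
    ∑ j ∈ Finset.range (⌊Real.log (Real.log n) / 2⌋₊ + 1), ((smallPrimes n).card : ℝ) ^ j * x ^ j
      ≤ 2 * √n := by
  set LL := Real.log (Real.log n) with hLLdef
  set r := ⌊LL / 2⌋₊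
  set α := (n : ℝ) ^ (1 / LL) with hα
  have hn1 : (1 : ℝ) ≤ n := by exact_mod_cast (by omega : 1 ≤ n)
  have hα1 : 1 ≤ α := Real.one_le_rpow hn1 (by positivity)
  have hcard : ((smallPrimes n).card : ℝ) ≤ α := by
    have h1 : (smallPrimes n).card ≤ ⌊α⌋₊ := by
      have : smallPrimes n ⊆ Finset.Icc 1 ⌊α⌋₊ := fun p hp =>
        Finset.mem_Icc.2 ⟨(Nat.prime_of_mem_primesLE hp).one_le, Nat.le_of_mem_primesLE hp⟩
      simpa using Finset.card_le_card this
    exact (Nat.cast_le.2 h1).trans (Nat.floor_le (by linarith))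
  have hpow : α ^ r ≤ √n := by
    rw [hα, Real.sqrt_eq_rpow, ← Real.rpow_mul_natCast (by linarith)]
    refine Real.rpow_le_rpow_of_exponent_le hn1 ?_
    have : (r : ℝ) ≤ LL / 2 := Nat.floor_le (by linarith)
    rw [one_div_mul_eq_div, div_le_iff₀ hLL]
    linarith
  calc ∑ j ∈ Finset.range (r + 1), ((smallPrimes n).card : ℝ) ^ j * x ^ j
      ≤ ∑ j ∈ Finset.range (r + 1), √n * (1 / 2) ^ j := by
        refine Finset.sum_le_sum fun j hj => ?_
        have hjr : j ≤ r := by have := Finset.mem_range.1 hj; omega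
        have h1 : ((smallPrimes n).card : ℝ) ^ j ≤ √n :=
          (pow_le_pow_left₀ (by positivity) hcard j).trans
            ((pow_le_pow_right₀ hα1 hjr).trans hpow)
        gcongr
    _ = √n * ∑ j ∈ Finset.range (r + 1), (1 / 2 : ℝ) ^ j := by rw [Finset.mul_sum]
    _ ≤ √n * 2 := by
        gcongr
        exact sum_geometric_two_le _
    _ = _ := mul_comm _ _

theorem tendsto_exp_div_exp_pow {s L x : ℕ → ℝ} (hs : Tendsto s atTop atTop)
    (hL : Tendsto (fun n => L n / s n ^ 2) atTop (𝓝 1)) {t : ℝ}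
    (hx0 : ∀ n, 0 ≤ x n) (hx : ∀ n, x n ≤ |t / s n|) :
    Tendsto (fun n => Real.exp (Real.exp 1 * x n * L n) / Real.exp 1 ^ ⌊s n ^ 2 / 2⌋₊)
      atTop (𝓝 0) := by
  have hbot : Tendsto (fun n => 1 - s n * (s n / 2 - 2 * Real.exp 1 * |t|)) atTop atBot := by
    have h1 : Tendsto (fun n => s n / 2 - 2 * Real.exp 1 * |t|) atTop atTop := by
      simpa [sub_eq_add_neg] using
        tendsto_atTop_add_const_right atTop (-(2 * Real.exp 1 * |t|))
          (hs.atTop_div_const (show (0 : ℝ) < 2 by norm_num))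
    have h2 := tendsto_neg_atTop_atBot.comp (hs.atTop_mul_atTop₀ h1)
    simpa [sub_eq_add_neg, Function.comp_def] using tendsto_atBot_add_const_left atTop 1 h2
  refine squeeze_zero' (Eventually.of_forall fun _ => by positivity) ?_
    (Real.tendsto_exp_atBot.comp hbot)
  filter_upwards [hs.eventually_gt_atTop 0, hL.eventually_le_const one_lt_two] with n hn hLn
  rw [Function.comp_apply, ← Real.exp_nat_mul, mul_one, ← Real.exp_sub]
  refine Real.exp_le_exp.2 ?_
  have h1 := Nat.lt_floor_add_one (s n ^ 2 / 2)
  rw [div_le_iff₀ (by positivity)] at hLn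
  have h2 : Real.exp 1 * x n * L n ≤ Real.exp 1 * |t / s n| * (2 * s n ^ 2) := by
    have h3 : Real.exp 1 * x n * L n ≤ Real.exp 1 * x n * (2 * s n ^ 2) :=
      mul_le_mul_of_nonneg_left hLn (mul_nonneg (Real.exp_pos 1).le (hx0 n))
    refine h3.trans ?_
    have := hx n
    gcongr
  have h4 : Real.exp 1 * |t / s n| * (2 * s n ^ 2) = s n * (2 * Real.exp 1 * |t|) := by
    rw [abs_div, abs_of_pos hn]
    field_simp
  linarith

/-! ### The normalized number of prime factors -/

theorem tendsto_integral_divisorCount_smallPrimes_sub_prod {P : ℕ → Measure ℕ}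
    (hP : ∀ n : ℕ, 1 ≤ n → IsProbabilityMeasure (P n)) {B : ℝ}
    (hB : ∀ᶠ n : ℕ in atTop, ∀ S ⊆ smallPrimes n,
      |(P n).real {m | ∀ p ∈ S, p ∣ m} - ∏ p ∈ S, 1 / (p : ℝ)| ≤ B / n) (t : ℝ) :
    Tendsto (fun n : ℕ =>
      ∫ m, (1 + (Complex.exp ((t / √(Real.log (Real.log n)) : ℝ) * Complex.I) - 1))
          ^ divisorCount (smallPrimes n) m ∂(P n)
        - ∏ p ∈ smallPrimes n,
          (1 + (Complex.exp ((t / √(Real.log (Real.log n)) : ℝ) * Complex.I) - 1) / p))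
      atTop (𝓝 0) := by
  set s : ℕ → ℝ := fun n => √(Real.log (Real.log n)) with hs_def
  have hs : Tendsto s atTop atTop := tendsto_sqrt_log_log_atTop
  set z : ℕ → ℂ := fun n => Complex.exp ((t / s n : ℝ) * Complex.I) - 1 with hz_def
  have hz : ∀ n, ‖z n‖ ≤ |t / s n| := fun n => norm_exp_ofReal_mul_I_sub_one_le _
  have hz1 : ∀ n, ‖1 + z n‖ ≤ 1 := fun n => by
    rw [hz_def, add_sub_cancel, Complex.norm_exp_ofReal_mul_I]
  have hu : Tendsto (fun n => |t / s n|) atTop (𝓝 0) := by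
    simpa using (hs.const_div_atTop t).abs
  have hratio : Tendsto (fun n => (∑ p ∈ smallPrimes n, 1 / (p : ℝ)) / s n ^ 2) atTop (𝓝 1) :=
    tendsto_div_sq_of_tendsto_sub_sq_div hs tendsto_sum_smallPrimes_sub_div_sqrt
  have htail := (tendsto_exp_div_exp_pow hs hratio (fun n => norm_nonneg (z n)) hz).const_mul 2
  have hmain : Tendsto (fun n : ℕ => 2 * B * (1 / √(n : ℝ))) atTop (𝓝 (2 * B * 0)) := by
    refine Tendsto.const_mul _ ?_
    exact (Real.tendsto_sqrt_atTop.comp tendsto_natCast_atTop_atTop).const_div_atTop 1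
  have hsum := hmain.add htail
  simp only [mul_zero, add_zero] at hsum
  refine squeeze_zero_norm' ?_ hsum
  filter_upwards [hB, hu.eventually_le_const (show (0 : ℝ) < 1 / 2 by norm_num),
    tendsto_log_log_natCast_atTop.eventually_gt_atTop 0, eventually_ge_atTop 3]
    with n hBn hun hLL hn
  have := hP n (by omega)
  have hn0 : (0 : ℝ) < n := by positivity
  have hδ : 0 ≤ B / n := (abs_nonneg _).trans (hBn ∅ (Finset.empty_subset _))
  have h1 := norm_integral_one_add_pow_divisorCount_sub_le (P n) (smallPrimes n) hδ
    (Real.one_le_exp zero_le_one) hBn (hz1 n) ⌊s n ^ 2 / 2⌋₊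
  refine h1.trans (add_le_add ?_ le_rfl)
  have hsq : s n ^ 2 = Real.log (Real.log n) := Real.sq_sqrt hLL.le
  rw [hsq]
  refine (mul_le_mul_of_nonneg_left (sum_card_smallPrimes_pow_le hn hLL (norm_nonneg _)
    ((hz n).trans hun)) hδ).trans (le_of_eq ?_)
  have hsn : √(n : ℝ) ^ 2 = n := Real.sq_sqrt hn0.le
  have hsn0 : √(n : ℝ) ≠ 0 := (Real.sqrt_pos.2 hn0).ne'
  field_simp
  rw [hsn]

/-- The number of distinct prime factors, centred and scaled by the mean and standard deviation
predicted by the Erdős–Kac theorem. -/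
noncomputable def normalizedOmega (n m : ℕ) : ℝ :=
  ((ArithmeticFunction.cardDistinctFactors m : ℝ) - Real.log (Real.log n))
    / √(Real.log (Real.log n))

/-- On average over `m`, prime factors above the truncation point are negligible in the
characteristic function. -/
theorem norm_integral_exp_normalizedOmega_sub_le {μ : Measure ℕ} [IsProbabilityMeasure μ] {n : ℕ}
    (hsupp : μ (Set.Icc 1 n)ᶜ = 0) (hLL : 0 < Real.log (Real.log n)) {Q : Finset ℕ}
    (hQ : Q ⊆ n.primesLE) (t : ℝ) :
    ‖∫ m, Complex.exp (t * normalizedOmega n m * Complex.I) ∂μ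
        - (∫ m, (1 + (Complex.exp ((t / √(Real.log (Real.log n)) : ℝ) * Complex.I) - 1))
            ^ divisorCount Q m ∂μ)
          * Complex.exp (-((t / √(Real.log (Real.log n)) : ℝ) * Complex.I
            * ((√(Real.log (Real.log n)) ^ 2 : ℝ) : ℂ)))‖
      ≤ |t| * ((∫ m, (divisorCount (n.primesLE \ Q) m : ℝ) ∂μ) / √(Real.log (Real.log n))) := by
  set s := √(Real.log (Real.log n)) with hs
  have hs0 : 0 < s := Real.sqrt_pos.2 hLL
  have hs2 : s ^ 2 = Real.log (Real.log n) := Real.sq_sqrt hLL.le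
  have hexp : ∀ m, (1 + (Complex.exp ((t / s : ℝ) * Complex.I) - 1)) ^ divisorCount Q m
      * Complex.exp (-((t / s : ℝ) * Complex.I * ((s ^ 2 : ℝ) : ℂ)))
      = Complex.exp (Complex.I * (t / s * (divisorCount Q m - s ^ 2) : ℝ)) := by
    intro m
    rw [add_sub_cancel, ← Complex.exp_nat_mul, ← Complex.exp_add]
    congr 1
    push_cast
    ring
  have hexp' : ∀ m, Complex.exp (t * normalizedOmega n m * Complex.I)
      = Complex.exp (Complex.I *
          (t / s * (ArithmeticFunction.cardDistinctFactors m - s ^ 2) : ℝ)) := by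
    intro m
    rw [normalizedOmega, ← hs, ← hs2]
    congr 1
    push_cast
    ring
  have hint : ∀ f : ℕ → ℝ, Integrable (fun m => Complex.exp (Complex.I * (f m : ℝ))) μ := by
    intro f
    refine integrable_of_norm_le _ 1 fun m => ?_
    rw [mul_comm, Complex.norm_exp_ofReal_mul_I]
  rw [← integral_mul_const]
  simp only [hexp, hexp']
  rw [← integral_sub (hint _) (hint _), ← integral_div, ← integral_const_mul]
  refine norm_integral_le_of_norm_le (((integrable_divisorCount μ _).div_const _).const_mul _) ?_
  have hae : ∀ᵐ m ∂μ, m ∈ Set.Icc 1 n := by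
    rw [ae_iff]
    exact hsupp
  filter_upwards [hae] with m hm
  set a := t / s * ((ArithmeticFunction.cardDistinctFactors m : ℝ) - s ^ 2) with ha
  set b := t / s * ((divisorCount Q m : ℝ) - s ^ 2) with hb
  have hab : Complex.exp (Complex.I * (a : ℝ)) - Complex.exp (Complex.I * (b : ℝ))
      = Complex.exp (Complex.I * (b : ℝ)) * (Complex.exp (Complex.I * ((a - b : ℝ) : ℂ)) - 1) := by
    rw [mul_sub, ← Complex.exp_add, mul_one]
    congr 2
    push_cast
    ring
  rw [hab, norm_mul, mul_comm Complex.I (b : ℂ), Complex.norm_exp_ofReal_mul_I, one_mul]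
  refine Real.norm_exp_I_mul_ofReal_sub_one_le.trans (le_of_eq ?_)
  have hω : (ArithmeticFunction.cardDistinctFactors m : ℝ)
      = divisorCount Q m + divisorCount (n.primesLE \ Q) m := by
    rw [cardDistinctFactors_eq_divisorCount hm, ← divisorCount_add_sdiff hQ]
    push_cast
    rfl
  have hdiff : a - b = t * (divisorCount (n.primesLE \ Q) m / s) := by
    rw [ha, hb, hω]; ring
  rw [hdiff, Real.norm_eq_abs, abs_mul, abs_of_nonneg (a := (divisorCount _ m : ℝ) / s)
    (by positivity)]

/-- Pointwise convergence of the characteristic function of `normalizedOmega` to the Gaussian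
one. -/
theorem tendsto_integral_exp_normalizedOmega {P : ℕ → Measure ℕ}
    (hP : ∀ n : ℕ, 1 ≤ n → IsProbabilityMeasure (P n))
    (hsupp : ∀ n : ℕ, 1 ≤ n → P n (Set.Icc 1 n)ᶜ = 0) {B A : ℝ}
    (hB : ∀ᶠ n : ℕ in atTop, ∀ S ⊆ smallPrimes n,
      |(P n).real {m | ∀ p ∈ S, p ∣ m} - ∏ p ∈ S, 1 / (p : ℝ)| ≤ B / n)
    (hA0 : 0 ≤ A)
    (hA : ∀ᶠ n : ℕ in atTop,
      ∫ m, (divisorCount (n.primesLE \ smallPrimes n) m : ℝ) ∂(P n)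
        ≤ A * ∑ p ∈ n.primesLE \ smallPrimes n, 1 / (p : ℝ)) (t : ℝ) :
    Tendsto (fun n : ℕ => ∫ m, Complex.exp (t * normalizedOmega n m * Complex.I) ∂(P n)) atTop
      (𝓝 (Complex.exp (-(t ^ 2 / 2 : ℝ) : ℂ))) := by
  have hmodel := tendsto_prod_one_add_div_mul_exp tendsto_sqrt_log_log_atTop
    (Q := smallPrimes) (fun n p hp => (Nat.prime_of_mem_primesLE hp).one_le)
    tendsto_sum_smallPrimes_sub_div_sqrt t
  have hcmp := (tendsto_integral_divisorCount_smallPrimes_sub_prod hP hB t).norm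
  rw [norm_zero] at hcmp
  have hcmp' : Tendsto (fun n : ℕ =>
      (∫ m, (1 + (Complex.exp ((t / √(Real.log (Real.log n)) : ℝ) * Complex.I) - 1))
          ^ divisorCount (smallPrimes n) m ∂(P n)
        - ∏ p ∈ smallPrimes n,
          (1 + (Complex.exp ((t / √(Real.log (Real.log n)) : ℝ) * Complex.I) - 1) / p))
        * Complex.exp (-((t / √(Real.log (Real.log n)) : ℝ) * Complex.I
            * ((√(Real.log (Real.log n)) ^ 2 : ℝ) : ℂ)))) atTop (𝓝 0) := by
    refine squeeze_zero_norm (fun n => le_of_eq ?_) hcmp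
    rw [norm_mul, Complex.norm_exp]
    simp [-Complex.ofReal_pow, -Complex.ofReal_div]
  obtain ⟨K, hK⟩ := exists_eventually_abs_sum_smallPrimes_sub_le
  have hlarge : Tendsto (fun n : ℕ =>
      ∫ m, Complex.exp (t * normalizedOmega n m * Complex.I) ∂(P n)
        - (∫ m, (1 + (Complex.exp ((t / √(Real.log (Real.log n)) : ℝ) * Complex.I) - 1))
            ^ divisorCount (smallPrimes n) m ∂(P n))
          * Complex.exp (-((t / √(Real.log (Real.log n)) : ℝ) * Complex.I
            * ((√(Real.log (Real.log n)) ^ 2 : ℝ) : ℂ)))) atTop (𝓝 0) := by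
    have hb := ((tendsto_const_add_log_div_sqrt K).const_mul A).const_mul |t|
    rw [mul_zero, mul_zero] at hb
    refine squeeze_zero_norm' ?_ hb
    filter_upwards [hA, hK, tendsto_log_log_natCast_atTop.eventually_gt_atTop 0,
      eventually_smallPrimes_subset, eventually_ge_atTop 1] with n hAn hKn hLL hsub hn
    have := hP n hn
    refine (norm_integral_exp_normalizedOmega_sub_le (hsupp n hn) hLL hsub t).trans ?_
    rw [← mul_div_assoc A]
    gcongr
    exact hAn.trans (mul_le_mul_of_nonneg_left hKn.2 hA0)
  have h := (hlarge.add hcmp').add hmodel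
  rw [add_zero, zero_add] at h
  exact h.congr fun n => by ring

/-- Lévy's continuity theorem and the portmanteau theorem turn the convergence of characteristic
functions into that of distribution functions. -/
theorem tendsto_measureReal_le_of_tendsto_integral_exp {Ω : Type*} [MeasurableSpace Ω]
    {μ : ℕ → Measure Ω} (hμ : ∀ n, IsProbabilityMeasure (μ n)) {Y : ℕ → Ω → ℝ}
    (hY : ∀ n, Measurable (Y n))
    (h : ∀ t : ℝ, Tendsto (fun n => ∫ ω, Complex.exp (t * Y n ω * Complex.I) ∂(μ n)) atTop
      (𝓝 (Complex.exp (-(t ^ 2 / 2 : ℝ) : ℂ)))) (x : ℝ) :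
    Tendsto (fun n => (μ n).real {ω | Y n ω ≤ x}) atTop
      (𝓝 ((gaussianReal 0 1).real (Set.Iic x))) := by
  let ν : ℕ → ProbabilityMeasure ℝ := fun n =>
    ⟨(μ n).map (Y n), Measure.isProbabilityMeasure_map (hY n).aemeasurable⟩
  let ν₀ : ProbabilityMeasure ℝ := ⟨gaussianReal 0 1, inferInstance⟩
  have hν : Tendsto ν atTop (𝓝 ν₀) := by
    refine ProbabilityMeasure.tendsto_of_tendsto_charFun fun t => ?_
    have h0 : charFun (ν₀ : Measure ℝ) t = Complex.exp (-(t ^ 2 / 2 : ℝ) : ℂ) := by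
      change charFun (gaussianReal 0 1) t = _
      rw [charFun_gaussianReal]
      simp
    rw [h0]
    refine (h t).congr fun n => ?_
    change _ = charFun ((μ n).map (Y n)) t
    rw [charFun_apply_real, integral_map (hY n).aemeasurable (by fun_prop)]
  have hfr : (ν₀ : Measure ℝ) (frontier (Set.Iic x)) = 0 := by
    rw [frontier_Iic]
    have := nullSingletonClass_gaussianReal (μ := 0) (v := 1) one_ne_zero
    exact measure_singleton (μ := gaussianReal 0 1) x
  have hlim := ProbabilityMeasure.tendsto_measure_of_null_frontier_of_tendsto' hν hfr
  have hlim' := (ENNReal.tendsto_toReal (measure_ne_top _ _)).comp hlim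
  refine hlim'.congr fun n => ?_
  change ((μ n).map (Y n) (Set.Iic x)).toReal = (μ n).real {ω | Y n ω ≤ x}
  rw [Measure.map_apply (hY n) measurableSet_Iic]
  rfl

theorem theorem2
    -- `P n` is a probability distribution on `{1, …, n}`, for each `n ≥ 1`
    (P : ℕ → Measure ℕ)
    (hP : ∀ n : ℕ, 1 ≤ n → IsProbabilityMeasure (P n))
    (hsupp : ∀ n : ℕ, 1 ≤ n → P n (Set.Icc 1 n)ᶜ = 0)
    -- its point masses are `1 / n + ε i n`
    (ε : ℕ → ℕ → ℝ)
    (hε : ∀ n : ℕ, 1 ≤ n → ∀ i ∈ Set.Icc 1 n, (P n).real {i} = 1 / (n : ℝ) + ε i n)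
    -- the condition on primes greater than `n ^ (1 / log log n)`
    (hlarge : ∃ C : ℝ, ∀ n : ℕ, 2 ≤ n → ∀ p : ℕ, p.Prime →
      (n : ℝ) ^ (1 / Real.log (Real.log n)) < (p : ℝ) →
        ∑ l ∈ Finset.Icc 1 (n / p), ε (l * p) n ≤ C / (p : ℝ))
    -- the condition on tuples of distinct primes of size at most `n ^ (1 / log log n)`
    (hsmall : ∃ D : ℝ, ∀ n : ℕ, 2 ≤ n → ∀ k : ℕ, 1 ≤ k → ∀ p : Fin k → ℕ,
      Function.Injective p → (∀ j, (p j).Prime) →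
      (∀ j, (p j : ℝ) ≤ (n : ℝ) ^ (1 / Real.log (Real.log n))) →
        0 ≤ ∑ l ∈ Finset.Icc 1 (n / ∏ j, p j), ε (l * ∏ j, p j) n ∧
        ∑ l ∈ Finset.Icc 1 (n / ∏ j, p j), ε (l * ∏ j, p j) n ≤ D / (n : ℝ)) :
    ∀ x : ℝ,
      Tendsto
        (fun n : ℕ => (P n).real
          {m : ℕ | m ≤ n ∧ (ArithmeticFunction.cardDistinctFactors m : ℝ) - Real.log (Real.log n)
            ≤ x * Real.sqrt (Real.log (Real.log n))})
        atTop (𝓝 ((gaussianReal 0 1).real (Set.Iic x))) := by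
  obtain ⟨C, hC⟩ := hlarge
  obtain ⟨D, hD⟩ := hsmall
  have hB : ∀ᶠ n : ℕ in atTop, ∀ S ⊆ smallPrimes n,
      |(P n).real {m | ∀ p ∈ S, p ∣ m} - ∏ p ∈ S, 1 / (p : ℝ)| ≤ (1 + |D|) / n := by
    filter_upwards [eventually_ge_atTop 2] with n hn S hS
    have := hP n (by omega)
    refine abs_measureReal_forall_dvd_sub_prod_le (by omega) (hsupp n (by omega))
      (hε n (by omega)) (hD n hn) (fun p hp => Nat.prime_of_mem_primesLE (hS hp)) fun p hp => ?_
    exact (Nat.cast_le.2 (Nat.le_of_mem_primesLE (hS hp))).trans (Nat.floor_le (by positivity))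
  have hA : ∀ᶠ n : ℕ in atTop,
      ∫ m, (divisorCount (n.primesLE \ smallPrimes n) m : ℝ) ∂(P n)
        ≤ (1 + |C|) * ∑ p ∈ n.primesLE \ smallPrimes n, 1 / (p : ℝ) := by
    filter_upwards [eventually_ge_atTop 2] with n hn
    have := hP n (by omega)
    have hprime : ∀ p ∈ n.primesLE \ smallPrimes n, p.Prime := fun p hp =>
      Nat.prime_of_mem_primesLE (Finset.mem_sdiff.1 hp).1
    refine integral_divisorCount_le (by omega) (hsupp n (by omega)) (hε n (by omega)) hprime
      fun p hp => hC n hn p (hprime p hp) ?_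
    by_contra! hle
    exact (Finset.mem_sdiff.1 hp).2 (Nat.mem_primesLE.2 ⟨Nat.le_floor hle, hprime p hp⟩)
  intro x
  have hchar := tendsto_integral_exp_normalizedOmega hP hsupp hB (by positivity) hA
  -- `P 0` need not be a probability measure, so the limit theorem is applied to `P (n + 1)`.
  have hlim := tendsto_measureReal_le_of_tendsto_integral_exp (μ := fun n => P (n + 1))
    (fun n => hP (n + 1) (by omega)) (Y := fun n => normalizedOmega (n + 1))
    (fun n => measurable_from_nat) (fun t => (tendsto_add_atTop_iff_nat 1).2 (hchar t)) x
  refine ((tendsto_add_atTop_iff_nat (f := fun n => (P n).real {m | normalizedOmega n m ≤ x})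
    1).1 hlim).congr' ?_
  filter_upwards [tendsto_log_log_natCast_atTop.eventually_gt_atTop 0, eventually_ge_atTop 1]
    with n hLL hn
  refine measureReal_congr ?_
  have hae : ∀ᵐ m ∂(P n), m ∈ Set.Icc 1 n := by
    rw [ae_iff]
    exact hsupp n hn
  filter_upwards [hae] with m hm
  refine propext ?_
  change normalizedOmega n m ≤ x ↔ m ≤ n ∧ _
  rw [normalizedOmega, div_le_iff₀ (Real.sqrt_pos.2 hLL), and_iff_right hm.2]
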